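/- Consider the deterministic synchronous CONGEST model. A network is a finite simple undirected graph on $n$ nodes; every node initially knows $n$, its own identifier, and the input data of its incident edges, which are numbered by local ports. The identifiers are distinct non-negative integers of size at most $n^c$, where $c$ is a fixed natural number. In each round every node sends a (possibly different) message to each of its neighbours, receives the messages of its neighbours and performs arbitrary deterministic local computation; messages have $O(\log n)$ bits. All nodes run the same program, and the running time is the number of rounds until every node has halted with its output. In Weighted Max-DiCut the input is a finite loopless directed graph $G=(V,E)$ with positive real arc weights $w$, and one wants a set $S\subseteq V$ that maximizes $$\mathrm{cut}(S)=\sum_{(u\to v)\in E,\ u\in S,\ v\notin S} w(u\to v).$$ The network is the underlying undirected graph of $G$, every node knows the directions and weights of its incident arcs, and every node outputs whether it belongs to $S$. **Theorem.** For every $\varepsilon>0$ and every $c$ there are a deterministic CONGEST algorithm and constants $B,C$, depending only on $\varepsilon$ and $c$, such that on every such input, with $n=|V|$, every assignment of identifiers in $\{0,\dots,n^c\}$ and every port numbering, all messages have at most $B\lfloor\log_2 n\rfloor$ bits, all nodes halt within $C\log^* n$ rounds, and the set $S$ that is output satisfies $$\mathrm{cut}(S)\ \ge\ \Bigl(\tfrac13-\varepsilon\Bigr)\max_{T\subseteq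 V}\mathrm{cut}(T).$$ Here $\log^* n$ is the least number of times that $\log_2$ has to be applied, starting with $n$, to reach a value at most $1$. -/

import Mathlib

noncomputable section

namespace Congest

/-- What a node knows before the first round: the number `n` of nodes of the network, its own
identifier, and, for each of its ports (in the order of the port numbers), the input data attached
to the link behind that port. -/
structure LocalInput (L : Type) where
  n : ℕ
  ident : ℕ
  links : List L

/-- A communication network on the node set `V`: an undirected graph, distinct identifiers, and at
each node `v` a numbering `0, …, deg v - 1` of its links by ports. The data `link v u : L` is what
`v` knows initially about its link to the neighbour `u`. A node is not told the identifiers of its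
neighbours. -/
structure Network (L : Type) (V : Type*) where
  graph : SimpleGraph V
  ident : V → ℕ
  ident_injective : Function.Injective ident
  deg : V → ℕ
  port : (v : V) → Fin (deg v) ≃ {u : V // graph.Adj v u}
  link : V → V → L

/-- The local input of the node `v`. -/
def Network.localInput {L : Type} {V : Type*} [Fintype V] (N : Network L V) (v : V) :
    LocalInput L where
  n := Fintype.card V
  ident := N.ident v
  links := List.ofFn fun i : Fin (N.deg v) => N.link v (N.port v i).1

/-- A deterministic distributed algorithm with outputs in `O`; all nodes run the same program.
Messages are bit strings; `send s i` is the message that a node in state `s` puts on its port `i`,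
and `recv s m` is its next state when `m` lists the messages arriving at its ports `0, 1, …`.
A node halts, with output `o`, as soon as it is in a state `s` with `output s = some o`. Local
computation is unrestricted, as usual in this model. -/
structure Algorithm (L O : Type) where
  State : Type
  init : LocalInput L → State
  send : State → ℕ → List Bool
  recv : State → List (List Bool) → State
  output : State → Option O

namespace Algorithm

variable {L O : Type} {V : Type*} (A : Algorithm L O) (N : Network L V)

/-- The message that node `u` puts on its port `i` when the current states are `σ`; a node that
has halted sends only empty messages. -/
def sent (σ : V → A.State) (u : V) (i : Fin (N.deg u)) : List Bool :=
  if (A.output (σ u)).isSome then [] else A.send (σ u) i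

/-- One synchronous round: the node `v` receives, at its port `i`, the message that the neighbour
`u` behind this port has put on the port of `u` that leads to `v`. The state of a node that has
halted does not change any more. -/
def step (σ : V → A.State) (v : V) : A.State :=
  if (A.output (σ v)).isSome then σ v
  else A.recv (σ v) (List.ofFn fun i : Fin (N.deg v) =>
    A.sent N σ (N.port v i).1 ((N.port (N.port v i).1).symm ⟨v, (N.port v i).2.symm⟩))

/-- The states of all nodes after `t` rounds. -/
def run [Fintype V] : ℕ → V → A.State
  | 0 => fun v => A.init (N.localInput v)
  | t + 1 => A.step N (run t)

/-- Every message of the execution has at most `b` bits. -/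
def MessagesAtMost [Fintype V] (b : ℕ) : Prop :=
  ∀ (t : ℕ) (v : V) (i : Fin (N.deg v)), (A.sent N (A.run N t) v i).length ≤ b

/-- After at most `T` rounds all nodes have halted, and `X v` is the output of `v`. -/
def HaltsWithin [Fintype V] (T : ℕ) (X : V → O) : Prop :=
  ∀ v : V, A.output (A.run N T v) = some (X v)

end Algorithm

end Congest

/-- The iterated logarithm `log* n`: the least number of times that the binary logarithm has to be
applied, starting with `n`, to reach a value that is at most `1`. -/
def logStar (n : ℕ) : ℕ :=
  sInf {k : ℕ | (Real.logb 2)^[k] (n : ℝ) ≤ 1}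

/-- A directed graph without loops whose arcs carry positive real weights. Antiparallel arcs are
allowed, with separate weights; only the values of `weight` on arcs matter. -/
structure WeightedDigraph (V : Type*) extends Digraph V where
  loopless : ∀ v, ¬ Adj v v
  weight : V → V → ℝ
  weight_pos : ∀ u v, Adj u v → 0 < weight u v

namespace WeightedDigraph

variable {V : Type*} (G : WeightedDigraph V)

open Classical in
/-- The weight of the arc from `u` to `v`, and `0` if there is no such arc. -/
def arcWeight (u v : V) : ℝ := if G.Adj u v then G.weight u v else 0

/-- The weight of the directed cut `(S, Sᶜ)`, where `S` is the set of all `v` with `X v = true`: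
the total weight of the arcs from `S` to its complement. -/
def diCut [Fintype V] (X : V → Bool) : ℝ :=
  ∑ u, ∑ v, if X u = true ∧ X v = false then G.arcWeight u v else 0

/-- The cut given by `X` is a `ρ`-approximation of the maximum directed cut. -/
def IsDiCutApprox [Fintype V] (ρ : ℝ) (X : V → Bool) : Prop :=
  ∀ Y : V → Bool, ρ * G.diCut Y ≤ G.diCut X

/-- The communication network of `G`: messages travel in both directions along each arc, and a
node knows, for each of its links, the weights of the outgoing and of the incoming arc on that
link, where `0` means that there is no arc in that direction. -/
def network (ident : V → ℕ) (ident_injective : Function.Injective ident) (deg : V → ℕ)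
    (port : (v : V) → Fin (deg v) ≃ {u : V // (SimpleGraph.fromRel G.Adj).Adj v u}) :
    Congest.Network (ℝ × ℝ) V where
  graph := SimpleGraph.fromRel G.Adj
  ident := ident
  ident_injective := ident_injective
  deg := deg
  port := port
  link v u := (G.arcWeight v u, G.arcWeight u v)

end WeightedDigraph

end

/-! A sequential 1/3-approximation is run one colour class at a time, on a colouring with constantly
many colours whose few monochromatic arcs are ignored.

Double greedy keeps a lower and an upper vector that agree on decided nodes. The cut values of these
two, plus that of the optimum overwritten by the decisions, never decrease in sum, so OPT is at most
three times the output (`cutForm_le_three_mul_of_doubleGreedy`). A class without inner arcs may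
decide simultaneously, since its marginal gains add up.

The colouring is only defective. A node picks a position where its Reed–Solomon codeword agrees with
those of differently coloured neighbours on at most a fraction `1 / y` of its link weight; position
and symbol form the new colour. With `y = log z` this turns `z ^ D` colours into `y ^ D`, and the
defects sum to at most twice the last `1 / y` (`publicValue_reduction_invariant`). After `log* n`
rounds the scale is constant. The ignored arcs cost little, because the output cuts a constant
fraction of the total weight (`cutForm_le_of_hasDefect`). -/

/-! ### The iterated logarithm and its truncated integer version -/

theorem exists_iterate_logb_le_one (x : ℝ) : ∃ k, (Real.logb 2)^[k] x ≤ 1 := by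
  obtain ⟨m, hm⟩ := exists_nat_ge x
  induction m generalizing x with
  | zero => exact ⟨0, by simpa using hm.trans (by norm_num)⟩
  | succ m ih =>
    by_cases h1 : x ≤ 1
    · exact ⟨0, h1⟩
    by_cases h2 : x ≤ 2
    · refine ⟨1, ?_⟩
      rw [Function.iterate_one, Real.logb_le_iff_le_rpow (by norm_num) (by linarith)]
      simpa using h2
    -- Bernoulli's inequality: above 2, each logarithm uses up at least one unit of the bound `m`.
    · have h3 : Real.logb 2 x ≤ x - 1 := by
        rw [Real.logb_le_iff_le_rpow (by norm_num) (by linarith)]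
        have := one_add_mul_self_le_rpow_one_add (s := 1) (p := x - 1) (by norm_num) (by linarith)
        norm_num at this ⊢
        linarith
      obtain ⟨k, hk⟩ := ih (Real.logb 2 x) (by push_cast at hm; linarith)
      exact ⟨k + 1, by rwa [Function.iterate_succ_apply]⟩

theorem iterate_logb_logStar_le_one (n : ℕ) : (Real.logb 2)^[logStar n] (n : ℝ) ≤ 1 :=
  Nat.sInf_mem (s := {k : ℕ | (Real.logb 2)^[k] (n : ℝ) ≤ 1}) (exists_iterate_logb_le_one n)

theorem one_le_logStar {n : ℕ} (hn : 2 ≤ n) : 1 ≤ logStar n := by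
  by_contra! h
  have h1 := iterate_logb_logStar_le_one n
  rw [Nat.lt_one_iff.1 h, Function.iterate_zero, id] at h1
  have : n ≤ 1 := by exact_mod_cast h1
  omega

theorem logStar_eq_zero {n : ℕ} (hn : n ≤ 1) : logStar n = 0 :=
  Nat.sInf_eq_zero.2 (Or.inl (by simpa using hn))

/-- One step of the iterated binary logarithm, stopped before the value falls below `K`. -/
def scale (K z : ℕ) : ℕ := if K ≤ Nat.log 2 z then Nat.log 2 z else z

theorem scale_le (K z : ℕ) : scale K z ≤ z := by
  unfold scale
  split_ifs
  · exact Nat.log_le_self 2 z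
  · exact le_rfl

theorem iterate_scale_le (K n t : ℕ) : (scale K)^[t] n ≤ n := by
  induction t with
  | zero => exact le_rfl
  | succ t ih =>
    rw [Function.iterate_succ_apply']
    exact (scale_le _ _).trans ih

/-- Rounding down keeps the integer iterates below the real ones until the freeze at `K`; from then
on the first alternative persists. -/
theorem log_iterate_scale_lt_or_le (K n t : ℕ) (hK : 1 ≤ K) :
    Nat.log 2 ((scale K)^[t] n) < K ∨ (((scale K)^[t] n : ℕ) : ℝ) ≤ (Real.logb 2)^[t] (n : ℝ) := by
  induction t with
  | zero => exact Or.inr le_rfl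
  | succ t ih =>
    rw [Function.iterate_succ_apply', Function.iterate_succ_apply']
    set z := (scale K)^[t] n
    by_cases h : K ≤ Nat.log 2 z
    · right
      rw [scale, if_pos h]
      have hz : z ≠ 0 := by
        intro h0
        rw [h0, Nat.log_zero_right] at h
        omega
      have hz0 : (0 : ℝ) < z := by exact_mod_cast Nat.pos_of_ne_zero hz
      have h1 : (z : ℝ) ≤ (Real.logb 2)^[t] (n : ℝ) := ih.resolve_left (by omega)
      refine le_trans ?_ (Real.logb_le_logb_of_le (by norm_num) hz0 h1)
      rw [Real.le_logb_iff_rpow_le (by norm_num) hz0, Real.rpow_natCast]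
      exact_mod_cast Nat.pow_log_le_self 2 hz
    · left
      rw [scale, if_neg h]
      omega

theorem log_iterate_scale_logStar_lt (K n : ℕ) (hK : 1 ≤ K) :
    Nat.log 2 ((scale K)^[logStar n] n) < K := by
  rcases log_iterate_scale_lt_or_le K n (logStar n) hK with h | h
  · exact h
  · have h1 : (scale K)^[logStar n] n ≤ 1 := by
      exact_mod_cast h.trans (iterate_logb_logStar_le_one n)
    rw [Nat.log_of_lt (by omega)]
    omega

/-! ### Codes with few agreements, and averaging over positions -/

open Finset Polynomial in
/-- The Reed–Solomon code. -/
theorem exists_code {p : ℕ} (hp : p.Prime) (k : ℕ) :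
    ∃ f : ℕ → ℕ → ℕ, (∀ m x, f m x < p) ∧ ∀ m < p ^ k, ∀ m' < p ^ k, m ≠ m' →
      #{x ∈ range p | f m x = f m' x} ≤ k := by
  have := Fact.mk hp
  obtain ⟨e⟩ : Nonempty (Fin (p ^ k) ↪ (Fin k → ZMod p)) :=
    Function.Embedding.nonempty_of_card_le (by simp [ZMod.card])
  let P : ℕ → (ZMod p)[X] := fun m =>
    if h : m < p ^ k then ((degreeLTEquiv (ZMod p) k).symm (e ⟨m, h⟩)).1 else 0
  refine ⟨fun m x => ((P m).eval (x : ZMod p)).val, fun m x => ZMod.val_lt _, ?_⟩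
  intro m hm m' hm' hne
  have hP : P m - P m' ≠ 0 := by
    rw [sub_ne_zero]
    simp only [P, hm, hm', dif_pos]
    intro h
    have := e.injective ((degreeLTEquiv (ZMod p) k).symm.injective (Subtype.ext h))
    exact hne (Fin.mk.inj_iff.1 this)
  have hdeg : ∀ i, P i ∈ degreeLT (ZMod p) k := by
    intro i
    simp only [P]
    split_ifs
    · exact Subtype.prop _
    · exact Submodule.zero_mem _
  have hd : (P m - P m').natDegree ≤ k :=
    natDegree_le_of_degree_le (mem_degreeLT.1 (Submodule.sub_mem _ (hdeg m) (hdeg m'))).le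
  refine le_trans ?_ ((Multiset.toFinset_card_le _).trans ((card_roots' (P m - P m')).trans hd))
  refine card_le_card_of_injOn (fun x : ℕ => (x : ZMod p)) ?_ ?_
  · intro x hx
    rw [mem_coe, mem_filter] at hx
    rw [mem_coe, Multiset.mem_toFinset, mem_roots hP, IsRoot, eval_sub, sub_eq_zero]
    exact ZMod.val_injective p hx.2
  · intro x hx x' hx' h
    simp only [coe_filter, mem_range, Set.mem_ofPred_eq] at hx hx'
    have h1 := congrArg ZMod.val h
    simpa [ZMod.val_natCast_of_lt hx.1, ZMod.val_natCast_of_lt hx'.1] using h1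

open Finset in
-- Bertrand's postulate gives a prime just above `D * (y + 1) * y`, so `D * (y + 1)` agreements are
-- at most a fraction `1 / y` of the positions. The side conditions come after the existentials so
-- that `choose` yields total functions of `y`.
theorem exists_code_family (D y : ℕ) :
    ∃ (p : ℕ) (f : ℕ → ℕ → ℕ), 1 ≤ D → 1 ≤ y → 0 < p ∧ p ≤ 2 * (D * (y + 1) * y) ∧
      (∀ m x, f m x < p) ∧ ∀ m < 2 ^ (D * (y + 1)), ∀ m' < 2 ^ (D * (y + 1)), m ≠ m' →
        y * #{x ∈ range p | f m x = f m' x} ≤ p := by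
  by_cases h : 1 ≤ D ∧ 1 ≤ y
  swap
  · exact ⟨0, fun _ _ => 0, fun h1 h2 => absurd ⟨h1, h2⟩ h⟩
  have h0 : D * (y + 1) * y ≠ 0 := by
    have : 0 < D * (y + 1) * y := Nat.mul_pos (Nat.mul_pos h.1 (Nat.succ_pos _)) h.2
    omega
  obtain ⟨p, hp, hlt, hle⟩ := Nat.exists_prime_lt_and_le_two_mul _ h0
  obtain ⟨f, hf, hfc⟩ := exists_code hp (D * (y + 1))
  have hpow : 2 ^ (D * (y + 1)) ≤ p ^ (D * (y + 1)) := Nat.pow_le_pow_left hp.two_le _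
  refine ⟨p, f, fun _ _ => ⟨hp.pos, hle, hf, fun m hm m' hm' hne => ?_⟩⟩
  calc _ ≤ y * (D * (y + 1)) :=
        Nat.mul_le_mul_left _ (hfc m (hm.trans_le hpow) m' (hm'.trans_le hpow) hne)
    _ ≤ p := by rw [mul_comm]; exact hlt.le

open Finset in
-- Each `u` is bad at no more than a fraction `1 / y` of the positions, so some position does at
-- least as well as the average.
theorem exists_point_sum_le {V : Type*} [Fintype V] (w : V → ℝ) (hw : ∀ u, 0 ≤ w u) (p y : ℕ)
    (hp : 0 < p) (r : V → ℕ → Prop) [∀ u x, Decidable (r u x)]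
    (h : ∀ u, y * #{x ∈ range p | r u x} ≤ p) :
    ∃ x < p, y * ∑ u, (if r u x then w u else 0) ≤ ∑ u, w u := by
  have hne : (range p).Nonempty := nonempty_range_iff.2 hp.ne'
  have : ∑ x ∈ range p, (y * ∑ u, (if r u x then w u else 0)) ≤ ∑ x ∈ range p, ∑ u, w u := by
    rw [← mul_sum, sum_comm, mul_sum, sum_comm]
    refine sum_le_sum fun u _ => ?_
    rw [sum_const, card_range, nsmul_eq_mul, ← sum_filter, sum_const, nsmul_eq_mul, ← mul_assoc]
    exact mul_le_mul_of_nonneg_right (by exact_mod_cast h u) (hw u)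
  obtain ⟨x, hx, hle⟩ := exists_le_of_sum_le hne this
  exact ⟨x, mem_range.1 hx, hle⟩

/-! ### Double greedy by colour classes -/

section DoubleGreedy

open Finset

variable {V : Type*}

/-- The vector that agrees with the decisions `X` on the colours below `j` and with `o` elsewhere. -/
noncomputable def hybrid (col : V → ℕ) (X : V → Bool) (o : V → ℝ) (j : ℕ) (u : V) : ℝ :=
  if col u < j then (if X u then 1 else 0) else o u

theorem hybrid_mono {col : V → ℕ} {X : V → Bool} {o o' : V → ℝ} (h : ∀ u, o u ≤ o' u) (j : ℕ)
    (u : V) : hybrid col X o j u ≤ hybrid col X o' j u := by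
  unfold hybrid
  by_cases hu : col u < j
  · simp [hu]
  · simpa [hu] using h u

theorem hybrid_succ_sub {col : V → ℕ} {X : V → Bool} {o : V → ℝ} (j : ℕ) (u : V) :
    hybrid col X o (j + 1) u - hybrid col X o j u
      = if col u = j then (if X u then 1 else 0) - o u else 0 := by
  unfold hybrid
  rcases lt_trichotomy (col u) j with h | h | h
  · simp [h, h.ne, Nat.lt_succ_of_lt h]
  · simp [h]
  · simp [h.not_gt, h.ne', show ¬ col u < j + 1 by omega]

variable [Fintype V] (a : V → V → ℝ)

/-- The multilinear extension of the directed cut function with arc weights `a`. -/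
noncomputable def cutForm (z : V → ℝ) : ℝ := ∑ u, ∑ v, a u v * (z u * (1 - z v))

/-- The partial derivative of `cutForm a` with respect to the coordinate `v`. -/
noncomputable def cutGain (z : V → ℝ) (v : V) : ℝ := ∑ u, (a v u * (1 - z u) - a u v * z u)

variable {a}

/-- Submodularity of the directed cut; it orders the gains at the lower, middle and upper hybrids.
-/
theorem cutGain_antitone (ha : ∀ u v, 0 ≤ a u v) {z z' : V → ℝ} (h : ∀ u, z u ≤ z' u) (v : V) :
    cutGain a z' v ≤ cutGain a z v := by
  refine sum_le_sum fun u _ => ?_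
  have h1 := mul_le_mul_of_nonneg_left (h u) (ha v u)
  have h2 := mul_le_mul_of_nonneg_left (h u) (ha u v)
  linarith

/-- Changing `z` on a set without inner arcs changes the cut by a sum of marginal gains. -/
theorem cutForm_sub_cutForm {z z' : V → ℝ}
    (h : ∀ u v, a u v * ((z' u - z u) * (z' v - z v)) = 0) :
    cutForm a z' - cutForm a z = ∑ v, (z' v - z v) * cutGain a z v := by
  have h1 : ∑ v, (z' v - z v) * cutGain a z v
      = ∑ u, ∑ v, (a u v * ((z' u - z u) * (1 - z v)) - a u v * ((z' v - z v) * z u)) := by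
    have h2 : ∀ v, (z' v - z v) * cutGain a z v
        = ∑ u, (a v u * ((z' v - z v) * (1 - z u)) - a u v * ((z' v - z v) * z u)) := by
      intro v
      rw [cutGain, mul_sum]
      exact sum_congr rfl fun u _ => by ring
    simp only [h2, sum_sub_distrib]
    congr 1
    rw [sum_comm]
  rw [h1, cutForm, cutForm, ← sum_sub_distrib]
  refine sum_congr rfl fun u _ => ?_
  rw [← sum_sub_distrib]
  refine sum_congr rfl fun v _ => ?_
  linear_combination -(h u v)

theorem cutForm_hybrid_succ {col : V → ℕ} (hcol : ∀ u v, col u = col v → a u v = 0)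
    (X : V → Bool) (o : V → ℝ) (j : ℕ) :
    cutForm a (hybrid col X o (j + 1)) - cutForm a (hybrid col X o j)
      = ∑ v, if col v = j then ((if X v then 1 else 0) - o v) * cutGain a (hybrid col X o j) v
          else 0 := by
  rw [cutForm_sub_cutForm]
  · refine sum_congr rfl fun v _ => ?_
    rw [hybrid_succ_sub, ite_mul, zero_mul]
  · intro u v
    rw [hybrid_succ_sub, hybrid_succ_sub]
    by_cases hu : col u = j
    · by_cases hv : col v = j
      · rw [hcol u v (hu.trans hv.symm), zero_mul]
      · simp [hv]
    · simp [hu]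

/-- The deterministic double greedy algorithm, processing colour class after colour class, attains
a third of the value of every fractional solution. -/
theorem cutForm_le_three_mul_of_doubleGreedy (ha : ∀ u v, 0 ≤ a u v) {col : V → ℕ}
    (hcol : ∀ u v, col u = col v → a u v = 0) {X : V → Bool}
    (hX : ∀ v, X v = true ↔ -cutGain a (hybrid col X (fun _ => 1) (col v)) v
      ≤ cutGain a (hybrid col X (fun _ => 0) (col v)) v)
    {o : V → ℝ} (ho0 : ∀ u, 0 ≤ o u) (ho1 : ∀ u, o u ≤ 1) :
    cutForm a o ≤ 3 * cutForm a (fun u => if X u then 1 else 0) := by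
  -- The potential starts at `cutForm a o` because the constant vectors 0 and 1 cut nothing. The
  -- rule `hX` is not circular: at level `col v` the hybrids read `X` only on smaller colours.
  have key : ∀ j, cutForm a o ≤ cutForm a (hybrid col X o j)
      + cutForm a (hybrid col X (fun _ => 0) j) + cutForm a (hybrid col X (fun _ => 1) j) := by
    intro j
    induction j with
    | zero =>
      have h1 : hybrid col X o 0 = o := by ext u; simp [hybrid]
      have h2 : cutForm a (hybrid col X (fun _ => 0) 0) = 0 := by simp [hybrid, cutForm]
      have h3 : cutForm a (hybrid col X (fun _ => 1) 0) = 0 := by simp [hybrid, cutForm]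
      rw [h1, h2, h3]
      linarith
    | succ j ih =>
      refine ih.trans (sub_nonneg.1 ?_)
      have h1 := cutForm_hybrid_succ hcol X o j
      have h2 := cutForm_hybrid_succ hcol X (fun _ => 0) j
      have h3 := cutForm_hybrid_succ hcol X (fun _ => 1) j
      have : 0 ≤ (cutForm a (hybrid col X o (j + 1)) - cutForm a (hybrid col X o j))
          + (cutForm a (hybrid col X (fun _ => 0) (j + 1))
              - cutForm a (hybrid col X (fun _ => 0) j))
          + (cutForm a (hybrid col X (fun _ => 1) (j + 1))
              - cutForm a (hybrid col X (fun _ => 1) j)) := by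
        rw [h1, h2, h3, ← sum_add_distrib, ← sum_add_distrib]
        refine sum_nonneg fun v _ => ?_
        by_cases hv : col v = j
        · simp only [hv, if_true]
          have hXv := hX v
          rw [hv] at hXv
          have g1 := cutGain_antitone ha (hybrid_mono (col := col) (X := X) ho0 j) v
          have g2 := cutGain_antitone ha (hybrid_mono (col := col) (X := X) ho1 j) v
          -- Here `β ≤ γ ≤ α`. Taking `v` in contributes `(1 - o v) * γ + α` with `-β ≤ α`; leaving
          -- it out contributes `-o v * γ - β` with `α < -β`.
          set α := cutGain a (hybrid col X (fun _ => 0) j) v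
          set β := cutGain a (hybrid col X (fun _ => 1) j) v
          set γ := cutGain a (hybrid col X o j) v
          have o0 := ho0 v
          have o1 := ho1 v
          by_cases hx : X v = true
          · have := hXv.1 hx
            simp only [hx, if_true]
            nlinarith
          · have : α < -β := not_le.1 fun h => hx (hXv.2 h)
            simp only [hx]
            simp only [Bool.false_eq_true, if_false]
            nlinarith
        · simp [hv]
      linarith
  obtain ⟨j, hj⟩ : ∃ j, ∀ u, col u < j :=
    ⟨univ.sup col + 1, fun u => Nat.lt_succ_of_le (le_sup (mem_univ u))⟩
  have h : ∀ o : V → ℝ, hybrid col X o j = fun u => if X u then 1 else 0 := by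
    intro o
    ext u
    simp [hybrid, hj u]
  have := key j
  rw [h, h, h] at this
  linarith

end DoubleGreedy

/-! ### Broadcast algorithms and their executions -/

namespace Congest

theorem foldr_bit_bits (n : ℕ) : n.bits.foldr Nat.bit 0 = n := by
  induction n using Nat.binaryRec' with
  | zero => simp
  | bit b n h ih => rw [Nat.bits_append_bit n b h, List.foldr_cons, ih]

variable {L O : Type}

/-- The algorithm in which every node has a public natural number, initially its identifier, sends
it to all neighbours in each round, updates it by `F` and halts after `R n` rounds. -/
def broadcast (R : ℕ → ℕ) (F : LocalInput L → ℕ → ℕ → List ℕ → ℕ) (out : ℕ → O) :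
    Algorithm L O where
  State := LocalInput L × ℕ × ℕ
  init i := (i, 0, i.ident)
  send s _ := s.2.2.bits
  recv s m := (s.1, s.2.1 + 1, F s.1 s.2.1 s.2.2 (m.map fun l => l.foldr Nat.bit 0))
  output s := if R s.1.n ≤ s.2.1 then some (out s.2.2) else none

variable {V : Type*} [Fintype V] (N : Network L V)

/-- The public numbers in the execution of `broadcast`, after `t` rounds. -/
def publicValue (F : LocalInput L → ℕ → ℕ → List ℕ → ℕ) : ℕ → V → ℕ
  | 0 => N.ident
  | t + 1 => fun v => F (N.localInput v) t (publicValue F t v)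
      (List.ofFn fun i : Fin (N.deg v) => publicValue F t (N.port v i).1)

variable (R : ℕ → ℕ) (F : LocalInput L → ℕ → ℕ → List ℕ → ℕ) (out : ℕ → O)

theorem run_broadcast {t : ℕ} (ht : t ≤ R (Fintype.card V)) (v : V) :
    (broadcast R F out).run N t v = (N.localInput v, t, publicValue N F t v) := by
  induction t generalizing v with
  | zero => rfl
  | succ t ih =>
    have h : ¬ R (Fintype.card V) ≤ t := by omega
    have hr : ∀ u, (broadcast R F out).run N t u = (N.localInput u, t, publicValue N F t u) :=
      ih (by omega)
    have ho : ∀ u, ((broadcast R F out).output ((broadcast R F out).run N t u)).isSome = false := by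
      intro u
      rw [hr u]
      simp [broadcast, Network.localInput, h]
    have hs : ∀ u i, (broadcast R F out).sent N ((broadcast R F out).run N t) u i
        = (publicValue N F t u).bits := by
      intro u i
      rw [Algorithm.sent, ho u, hr u]
      rfl
    change (broadcast R F out).step N ((broadcast R F out).run N t) v = _
    rw [Algorithm.step, ho v]
    simp only [hs, hr v]
    simp [broadcast, publicValue, List.map_ofFn, Function.comp_def, foldr_bit_bits]

theorem run_broadcast_of_le {t : ℕ} (ht : R (Fintype.card V) ≤ t) (v : V) :
    (broadcast R F out).run N t v = (N.localInput v, R (Fintype.card V),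
      publicValue N F (R (Fintype.card V)) v) := by
  induction t, ht using Nat.le_induction generalizing v with
  | base => exact run_broadcast N R F out le_rfl v
  | succ t ht ih =>
    change (broadcast R F out).step N ((broadcast R F out).run N t) v = _
    have ho : ((broadcast R F out).output ((broadcast R F out).run N t v)).isSome = true := by
      rw [ih v]
      simp [broadcast, Network.localInput]
    rw [Algorithm.step, ho, ← ih v]
    exact if_pos rfl

theorem messagesAtMost_broadcast {b : ℕ}
    (h : ∀ t < R (Fintype.card V), ∀ v, (publicValue N F t v).size ≤ b) :
    (broadcast R F out).MessagesAtMost N b := by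
  intro t v i
  rcases lt_or_ge t (R (Fintype.card V)) with ht | ht
  · rw [Algorithm.sent]
    split_ifs
    · simp
    · rw [run_broadcast N R F out ht.le v]
      simpa [broadcast, Nat.size_eq_bits_len] using h t ht v
  · have ho : ((broadcast R F out).output ((broadcast R F out).run N t v)).isSome = true := by
      rw [run_broadcast_of_le N R F out ht v]
      simp [broadcast, Network.localInput]
    rw [Algorithm.sent, ho, if_pos rfl]
    simp

theorem haltsWithin_broadcast :
    (broadcast R F out).HaltsWithin N (R (Fintype.card V))
      (fun v => out (publicValue N F (R (Fintype.card V)) v)) := by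
  intro v
  rw [run_broadcast N R F out le_rfl v]
  simp [broadcast, Network.localInput]

/-- The sum of `g` over the links of a node, given the list of the numbers received on them. -/
def linkSum (inp : LocalInput L) (vals : List ℕ) (g : L → ℕ → ℝ) : ℝ :=
  (List.zipWith g inp.links vals).sum

/-- Nodes sum over ports, the analysis over all of `V`: reindex along `port` and pad with vanishing
terms. -/
theorem linkSum_localInput (ξ : V → ℕ) (v : V) (g : L → ℕ → ℝ)
    (h : ∀ u, ¬ N.graph.Adj v u → g (N.link v u) (ξ u) = 0) :
    linkSum (N.localInput v) (List.ofFn fun i : Fin (N.deg v) => ξ (N.port v i).1) g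
      = ∑ u, g (N.link v u) (ξ u) := by
  classical
  have h1 : List.zipWith g (N.localInput v).links
      (List.ofFn fun i : Fin (N.deg v) => ξ (N.port v i).1)
      = List.ofFn fun i : Fin (N.deg v) => g (N.link v (N.port v i).1) (ξ (N.port v i).1) := by
    apply List.ext_getElem <;> simp [Network.localInput]
  rw [linkSum, h1, List.sum_ofFn,
    Equiv.sum_comp (N.port v) (fun u => g (N.link v u.1) (ξ u.1))]
  rw [← Finset.sum_subtype {u | N.graph.Adj v u} (by simp) (fun u => g (N.link v u) (ξ u))]
  exact Finset.sum_subset (Finset.subset_univ _) fun u _ hu => h u (by simpa using hu)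

end Congest

/-! ### Weighted defective colourings -/

section Defect

open Finset

variable {V : Type*} [Fintype V] {b : V → V → ℝ} {ξ ξ' : V → ℕ} {E : ℝ}

/-- The colouring `ξ` has defect `E`: at each node, the weight of the links to nodes of the same
colour is at most the fraction `E` of the weight of all links. -/
def HasDefect (b : V → V → ℝ) (ξ : V → ℕ) (E : ℝ) : Prop :=
  ∀ v, ∑ u, (if ξ u = ξ v then b v u else 0) ≤ E * ∑ u, b v u

theorem HasDefect.mono (hb : ∀ u v, 0 ≤ b u v) {E' : ℝ} (h : HasDefect b ξ E) (hE : E ≤ E') :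
    HasDefect b ξ E' := fun v =>
  (h v).trans (mul_le_mul_of_nonneg_right hE (sum_nonneg fun u _ => hb v u))

theorem hasDefect_of_injective (hb : ∀ u v, 0 ≤ b u v) (hb0 : ∀ v, b v v = 0)
    (h : Function.Injective ξ) (hE : 0 ≤ E) : HasDefect b ξ E := by
  intro v
  refine le_of_eq_of_le (sum_eq_zero fun u _ => ?_)
    (mul_nonneg hE (sum_nonneg fun u _ => hb v u))
  split_ifs with hu
  · rw [h hu, hb0]
  · rfl

/-- A link monochromatic under `ξ'` either was so under `ξ`, or joins different old colours whose
codewords agree at the common position; the two defects add. Symbols are below `p`, so division by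
`p` recovers the position. -/
theorem HasDefect.recolor (hb : ∀ u v, 0 ≤ b u v) (h : HasDefect b ξ E) {p y : ℕ} (hy : 1 ≤ y)
    {f : ℕ → ℕ → ℕ} (hf : ∀ m x, f m x < p) {z : V → ℕ}
    (hz : ∀ v, y * ∑ u, (if ξ u ≠ ξ v ∧ f (ξ u) (z v) = f (ξ v) (z v) then b v u else 0)
      ≤ ∑ u, b v u)
    (hξ' : ∀ v, ξ' v = z v * p + f (ξ v) (z v)) : HasDefect b ξ' (E + 1 / y) := by
  intro v
  have hy0 : (0 : ℝ) < y := by exact_mod_cast hy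
  have h1 : ∑ u, (if ξ u ≠ ξ v ∧ f (ξ u) (z v) = f (ξ v) (z v) then b v u else 0)
      ≤ 1 / y * ∑ u, b v u := by
    rw [one_div, ← div_eq_inv_mul, le_div_iff₀ hy0, mul_comm]
    exact hz v
  rw [add_mul]
  refine le_trans ?_ (add_le_add (h v) h1)
  rw [← sum_add_distrib]
  refine sum_le_sum fun u _ => ?_
  by_cases hu : ξ' u = ξ' v
  · have hp : 0 < p := (Nat.zero_le _).trans_lt (hf 0 0)
    rw [hξ', hξ'] at hu
    have hzz : z u = z v := by
      have := congrArg (· / p) hu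
      simpa [Nat.add_comm, Nat.add_mul_div_right _ _ hp, Nat.div_eq_of_lt (hf _ _)] using this
    rw [hzz] at hu
    have hff : f (ξ u) (z v) = f (ξ v) (z v) := Nat.add_left_cancel hu
    rw [hξ' u, hξ' v, hzz, hff, if_pos rfl]
    by_cases hc : ξ u = ξ v <;> simp [hc]
  · rw [if_neg hu]
    refine add_nonneg ?_ ?_ <;> split_ifs <;> first | exact hb v u | exact le_rfl

/-- Good decisions for the double greedy algorithm, applied to the arcs whose ends have different
colours, are also good for all arcs. -/
theorem cutForm_le_of_hasDefect {a : V → V → ℝ} (ha : ∀ u v, 0 ≤ a u v) {col : V → ℕ}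
    (hE0 : 0 ≤ E) (hE : E ≤ 1 / 2) (hcol : HasDefect (fun v u => a v u + a u v) col E)
    {x : V → ℝ} (hx0 : ∀ u, 0 ≤ x u) (hx1 : ∀ u, x u ≤ 1)
    (hx : ∀ o : V → ℝ, (∀ u, 0 ≤ o u) → (∀ u, o u ≤ 1) →
      cutForm (fun u v => if col u = col v then 0 else a u v) o
        ≤ 3 * cutForm (fun u v => if col u = col v then 0 else a u v) x)
    {o : V → ℝ} (ho0 : ∀ u, 0 ≤ o u) (ho1 : ∀ u, o u ≤ 1) :
    cutForm a o ≤ (3 + 24 * E) * cutForm a x := by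
  set a' : V → V → ℝ := fun u v => if col u = col v then 0 else a u v with ha'
  have hle : ∀ u v, a' u v ≤ a u v := by
    intro u v
    simp only [ha']
    split_ifs
    · exact ha u v
    · exact le_rfl
  have hmono : ∑ u, ∑ v, (a u v - a' u v) ≤ E * ∑ u, ∑ v, a u v := by
    have h1 := sum_le_sum fun v (_ : v ∈ univ) => hcol v
    -- Summing over nodes counts each monochromatic arc at both ends.
    have h2 : ∑ v, ∑ u, (if col u = col v then a v u + a u v else 0)
        = 2 * ∑ u, ∑ v, (a u v - a' u v) := by
      have : ∀ v u, (if col u = col v then a v u + a u v else 0)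
          = (a v u - a' v u) + (a u v - a' u v) := by
        intro v u
        simp only [ha']
        by_cases h : col u = col v
        · simp [h]
        · simp [h, Ne.symm h]
      simp only [this, sum_add_distrib]
      rw [sum_comm (f := fun v u => a u v - a' u v)]
      ring
    have h3 : ∑ v, E * ∑ u, (a v u + a u v) = 2 * (E * ∑ u, ∑ v, a u v) := by
      rw [← mul_sum]
      simp only [sum_add_distrib]
      rw [sum_comm (f := fun v u => a u v)]
      ring
    linarith
  have hsub : ∑ u, ∑ v, (a u v - a' u v) = ∑ u, ∑ v, a u v - ∑ u, ∑ v, a' u v := by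
    simp only [sum_sub_distrib]
  -- The vector 1/2 cuts a quarter of the weight of `a'`, `x` at least a third of that, and `a'`
  -- keeps half of the weight of `a`; hence the constant 24 below.
  have hquarter := hx (fun _ => 1 / 2) (fun _ => by norm_num) (fun _ => by norm_num)
  have hq : cutForm a' (fun _ => 1 / 2) = 1 / 4 * ∑ u, ∑ v, a' u v := by
    simp only [cutForm, mul_sum]
    exact sum_congr rfl fun u _ => sum_congr rfl fun v _ => by ring
  have hxle : cutForm a' x ≤ cutForm a x :=
    sum_le_sum fun u _ => sum_le_sum fun v _ =>
      mul_le_mul_of_nonneg_right (hle u v) (mul_nonneg (hx0 u) (sub_nonneg.2 (hx1 v)))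
  have hole : cutForm a o - cutForm a' o ≤ ∑ u, ∑ v, (a u v - a' u v) := by
    rw [cutForm, cutForm, ← sum_sub_distrib]
    refine sum_le_sum fun u _ => ?_
    rw [← sum_sub_distrib]
    refine sum_le_sum fun v _ => ?_
    rw [← sub_mul]
    refine mul_le_of_le_one_right (sub_nonneg.2 (hle u v)) ?_
    exact mul_le_one₀ (ho1 u) (sub_nonneg.2 (ho1 v)) (by linarith [ho0 v])
  have hO := hx o ho0 ho1
  have hW0 : 0 ≤ ∑ u, ∑ v, a u v := sum_nonneg fun u _ => sum_nonneg fun v _ => ha u v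
  have hW : ∑ u, ∑ v, a u v ≤ 24 * cutForm a x := by nlinarith
  nlinarith [mul_le_mul_of_nonneg_left hW hE0]

end Defect

/-! ### Numerical estimates -/

section Arithmetic

theorem size_le_of_lt_pow {n m e : ℕ} (hn : 2 ≤ n) (h : m < n ^ e) :
    m.size ≤ 2 * e * Nat.log 2 n := by
  rw [Nat.size_le]
  have h1 : 1 ≤ Nat.log 2 n := Nat.log_pos (by norm_num) hn
  calc m < n ^ e := h
    _ ≤ (2 ^ (Nat.log 2 n + 1)) ^ e :=
        Nat.pow_le_pow_left (Nat.lt_pow_succ_log_self (by norm_num) n).le e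
    _ = 2 ^ ((Nat.log 2 n + 1) * e) := by rw [pow_mul]
    _ ≤ 2 ^ (2 * e * Nat.log 2 n) := Nat.pow_le_pow_right (by norm_num) (by nlinarith)

/-- Since `p` is at most `4 * D * y ^ 2`, its square is of order `y ^ 4`; a fifth factor `y` absorbs
the constant `16 * D ^ 2`. -/
theorem mul_self_le_pow {D y p : ℕ} (hD : 5 ≤ D) (hy : 16 * D ^ 2 ≤ y)
    (hp : p ≤ 2 * (D * (y + 1) * y)) : p * p ≤ y ^ D := by
  have hy1 : 1 ≤ y := by nlinarith
  have h1 : p ≤ 4 * D * y ^ 2 := by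
    refine hp.trans ?_
    have : D * (y + 1) * y ≤ D * (2 * y) * y := by gcongr; omega
    nlinarith
  calc p * p ≤ (4 * D * y ^ 2) * (4 * D * y ^ 2) := Nat.mul_le_mul h1 h1
    _ = 16 * D ^ 2 * y ^ 4 := by ring
    _ ≤ y * y ^ 4 := Nat.mul_le_mul_right _ hy
    _ = y ^ 5 := by ring
    _ ≤ y ^ D := Nat.pow_le_pow_right hy1 hD

theorem two_mul_log_le {z : ℕ} (h : 1 ≤ Nat.log 2 z) : 2 * Nat.log 2 z ≤ z := by
  have hz : z ≠ 0 := by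
    rintro rfl
    simp at h
  refine le_trans ?_ (Nat.pow_log_le_self 2 hz)
  obtain ⟨k, hk⟩ := Nat.exists_eq_add_of_le h
  rw [hk, pow_add]
  have : k < 2 ^ k := Nat.lt_two_pow_self
  omega

end Arithmetic

/-! ### The algorithm for directed cuts -/

namespace WeightedDigraph

open Congest Finset

section Update

variable (Q K : ℕ) (p : ℕ → ℕ) (f : ℕ → ℕ → ℕ → ℕ)

/-- The new colour of a node of colour `x`, computed from the colours `vals` of its neighbours with
the code `f` of length `p`: a position at which few neighbours agree, and the symbol there. -/
noncomputable def recolor (p : ℕ) (f : ℕ → ℕ → ℕ) (y : ℕ) (inp : LocalInput (ℝ × ℝ)) (x : ℕ)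
    (vals : List ℕ) : ℕ :=
  let z := Classical.epsilon fun z => z < p ∧
    y * linkSum inp vals (fun l m => if m ≠ x ∧ f m z = f x z then l.1 + l.2 else 0)
      ≤ linkSum inp vals (fun l _ => l.1 + l.2)
  z * p + f x z

/-- The decision of a node of colour `x` in the double greedy algorithm. The value of a neighbour
is its colour, or `Q` if it has decided to stay out of the set, or `Q + 1` if it is in. -/
def GreedyChoice (inp : LocalInput (ℝ × ℝ)) (x : ℕ) (vals : List ℕ) : Prop :=
  -linkSum inp vals (fun l m => if m = x then 0 else
      l.1 * (if m = Q then 1 else 0) - l.2 * (if m = Q then 0 else 1))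
    ≤ linkSum inp vals (fun l m => if m = x then 0 else
      l.1 * (if m = Q + 1 then 0 else 1) - l.2 * (if m = Q + 1 then 1 else 0))

open Classical in
/-- The update of the public numbers: for `logStar n` rounds the nodes reduce the number of
colours, afterwards the nodes of colour `j` decide in round `logStar n + j`. -/
noncomputable def diCutUpdate (inp : LocalInput (ℝ × ℝ)) (t x : ℕ) (vals : List ℕ) : ℕ :=
  if t < logStar inp.n then
    if K ≤ Nat.log 2 ((scale K)^[t] inp.n) then
      recolor (p (Nat.log 2 ((scale K)^[t] inp.n))) (f (Nat.log 2 ((scale K)^[t] inp.n)))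
        (Nat.log 2 ((scale K)^[t] inp.n)) inp x vals
    else x
  else if x = t - logStar inp.n ∧ x < Q then
    if GreedyChoice Q inp x vals then Q + 1 else Q
  else x

end Update

variable {V : Type*} (G : WeightedDigraph V)

theorem arcWeight_nonneg (u v : V) : 0 ≤ G.arcWeight u v := by
  unfold arcWeight
  split_ifs with h
  · exact (G.weight_pos u v h).le
  · exact le_rfl

theorem arcWeight_of_not_adj {u v : V} (h : ¬ G.Adj u v) : G.arcWeight u v = 0 := if_neg h

theorem arcWeight_self (v : V) : G.arcWeight v v = 0 := G.arcWeight_of_not_adj (G.loopless v)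

variable [Fintype V]

theorem diCut_eq_cutForm (X : V → Bool) :
    G.diCut X = cutForm G.arcWeight (fun u => if X u then 1 else 0) := by
  refine sum_congr rfl fun u _ => sum_congr rfl fun v _ => ?_
  by_cases hu : X u = true <;> by_cases hv : X v = true <;> simp [hu, hv]

theorem diCut_of_subsingleton [Subsingleton V] (X : V → Bool) : G.diCut X = 0 := by
  refine sum_eq_zero fun u _ => sum_eq_zero fun v _ => ?_
  rw [Subsingleton.elim v u, arcWeight_self, ite_self]

variable (ident : V → ℕ) (ident_injective : Function.Injective ident) (deg : V → ℕ)
  (port : (v : V) → Fin (deg v) ≃ {u : V // (SimpleGraph.fromRel G.Adj).Adj v u})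

local notation "𝒩" => G.network ident ident_injective deg port

theorem linkSum_network (ξ : V → ℕ) (v : V) (g : ℝ × ℝ → ℕ → ℝ) (hg : ∀ m, g (0, 0) m = 0) :
    linkSum ((𝒩).localInput v) (List.ofFn fun i : Fin ((𝒩).deg v) => ξ ((𝒩).port v i).1) g
      = ∑ u, g (G.arcWeight v u, G.arcWeight u v) (ξ u) := by
  refine linkSum_localInput (𝒩) ξ v g fun u hu => ?_
  have h : ¬ G.Adj v u ∧ ¬ G.Adj u v := by
    by_cases huv : v = u
    · subst huv
      exact ⟨G.loopless v, G.loopless v⟩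
    · have : ¬ (SimpleGraph.fromRel G.Adj).Adj v u := hu
      rw [SimpleGraph.fromRel_adj] at this
      tauto
  change g (G.arcWeight v u, G.arcWeight u v) (ξ u) = 0
  rw [G.arcWeight_of_not_adj h.1, G.arcWeight_of_not_adj h.2, hg]

/-- Averaging supplies the witness that makes the `Classical.epsilon` in `recolor` meaningful.
Neighbours of equal colour are excluded, as they agree everywhere. -/
theorem recolor_spec {p : ℕ} {f : ℕ → ℕ → ℕ} {y M : ℕ} (hp : 0 < p)
    (hf : ∀ m < M, ∀ m' < M, m ≠ m' → y * #{x ∈ range p | f m x = f m' x} ≤ p)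
    {ξ : V → ℕ} (hξ : ∀ v, ξ v < M) (v : V) :
    ∃ z < p, y * ∑ u, (if ξ u ≠ ξ v ∧ f (ξ u) z = f (ξ v) z then
          G.arcWeight v u + G.arcWeight u v else 0) ≤ ∑ u, (G.arcWeight v u + G.arcWeight u v) ∧
      recolor p f y ((𝒩).localInput v) (ξ v)
        (List.ofFn fun i : Fin ((𝒩).deg v) => ξ ((𝒩).port v i).1) = z * p + f (ξ v) z := by
  have hex : ∃ z, z < p ∧
      y * linkSum ((𝒩).localInput v) (List.ofFn fun i : Fin ((𝒩).deg v) => ξ ((𝒩).port v i).1)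
          (fun l m => if m ≠ ξ v ∧ f m z = f (ξ v) z then l.1 + l.2 else 0)
        ≤ linkSum ((𝒩).localInput v) (List.ofFn fun i : Fin ((𝒩).deg v) => ξ ((𝒩).port v i).1)
          (fun l _ => l.1 + l.2) := by
    obtain ⟨z, hz, hle⟩ := exists_point_sum_le (fun u => G.arcWeight v u + G.arcWeight u v)
      (fun u => add_nonneg (G.arcWeight_nonneg _ _) (G.arcWeight_nonneg _ _)) p y hp
      (fun u x => ξ u ≠ ξ v ∧ f (ξ u) x = f (ξ v) x) (fun u => by
        by_cases hu : ξ u = ξ v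
        · simp [hu]
        · simpa [hu] using hf _ (hξ u) _ (hξ v) hu)
    refine ⟨z, hz, ?_⟩
    rw [linkSum_network _ _ _ _ _ _ _ _ (by simp), linkSum_network _ _ _ _ _ _ _ _ (by simp)]
    exact hle
  have heps : ∀ P : ℕ → Prop, (∃ z, P z) → ∃ z, P z ∧ Classical.epsilon P = z :=
    fun P h => ⟨_, Classical.epsilon_spec h, rfl⟩
  obtain ⟨z, ⟨hz, hle⟩, hzeq⟩ := heps _ hex
  rw [linkSum_network _ _ _ _ _ _ _ _ (by simp), linkSum_network _ _ _ _ _ _ _ _ (by simp)] at hle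
  refine ⟨z, hz, hle, ?_⟩
  simp only [recolor]
  rw [hzeq]

variable {Q K : ℕ} {p : ℕ → ℕ} {f : ℕ → ℕ → ℕ → ℕ}

/-- Passing from scale `Z` to `y = log Z`, the bound `2 * y ≤ Z` gives `2 / Z + 1 / y ≤ 2 / y`, so
the defect bound reproduces itself. The `max` keeps it at most `2 / K` even for small networks. -/
theorem publicValue_reduction_invariant {D : ℕ} (hD : 5 ≤ D) (hK : 16 * D ^ 2 ≤ K)
    (hp : ∀ y, 1 ≤ y → 0 < p y ∧ p y ≤ 2 * (D * (y + 1) * y) ∧ (∀ m x, f y m x < p y) ∧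
      ∀ m < 2 ^ (D * (y + 1)), ∀ m' < 2 ^ (D * (y + 1)), m ≠ m' →
        y * #{x ∈ range (p y) | f y m x = f y m' x} ≤ p y)
    (hident : ∀ v, ident v < Fintype.card V ^ D) {t : ℕ} (ht : t ≤ logStar (Fintype.card V)) :
    (∀ v, publicValue (𝒩) (diCutUpdate Q K p f) t v < ((scale K)^[t] (Fintype.card V)) ^ D) ∧
      HasDefect (fun v u => G.arcWeight v u + G.arcWeight u v)
        (publicValue (𝒩) (diCutUpdate Q K p f) t)
        (2 / max ((scale K)^[t] (Fintype.card V) : ℕ) K) := by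
  have hb : ∀ u v, 0 ≤ G.arcWeight u v + G.arcWeight v u := fun u v =>
    add_nonneg (G.arcWeight_nonneg _ _) (G.arcWeight_nonneg _ _)
  have hK1 : 1 ≤ K := by nlinarith
  induction t with
  | zero =>
    refine ⟨hident, hasDefect_of_injective hb (fun v => ?_) ident_injective (by positivity)⟩
    rw [G.arcWeight_self, add_zero]
  | succ t ih =>
    obtain ⟨hlt, hdef⟩ := ih (by omega)
    have hv : ∀ v, publicValue (𝒩) (diCutUpdate Q K p f) (t + 1) v
        = diCutUpdate Q K p f ((𝒩).localInput v) t (publicValue (𝒩) (diCutUpdate Q K p f) t v)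
          (List.ofFn fun i : Fin ((𝒩).deg v) =>
            publicValue (𝒩) (diCutUpdate Q K p f) t ((𝒩).port v i).1) := fun v => rfl
    have hn : ∀ v, ((𝒩).localInput v).n = Fintype.card V := fun v => rfl
    have htl : t < logStar (Fintype.card V) := ht
    simp only [diCutUpdate, hn, if_pos htl] at hv
    rw [Function.iterate_succ_apply']
    generalize (scale K)^[t] (Fintype.card V) = Z at *
    generalize publicValue (𝒩) (diCutUpdate Q K p f) (t + 1) = ξ' at *
    generalize publicValue (𝒩) (diCutUpdate Q K p f) t = ξ at *
    by_cases hy : K ≤ Nat.log 2 Z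
    · simp only [if_pos hy] at hv
      rw [scale, if_pos hy]
      have hZ := two_mul_log_le (hK1.trans hy)
      have hM : ∀ v, ξ v < 2 ^ (D * (Nat.log 2 Z + 1)) := by
        intro v
        refine (hlt v).trans_le ?_
        rw [mul_comm, pow_mul]
        exact Nat.pow_le_pow_left (Nat.lt_pow_succ_log_self (by norm_num) Z).le D
      generalize Nat.log 2 Z = y at *
      have hy1 : 1 ≤ y := hK1.trans hy
      obtain ⟨hp0, hple, hf, hfc⟩ := hp y hy1
      choose z hzp hz hrec using
        G.recolor_spec ident ident_injective deg port hp0 hfc hM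
      have hξ' : ∀ v, ξ' v = z v * p y + f y (ξ v) (z v) := fun v => (hv v).trans (hrec v)
      constructor
      · intro v
        refine lt_of_lt_of_le ?_ (mul_self_le_pow hD (hK.trans hy) hple)
        rw [hξ']
        have h1 := hf (ξ v) (z v)
        have h2 : (z v + 1) * p y ≤ p y * p y := Nat.mul_le_mul_right _ (hzp v)
        linarith
      · refine (hdef.recolor hb hy1 hf hz hξ').mono hb ?_
        have hy0 : (0 : ℝ) < y := by exact_mod_cast hy1
        have e1 : ((max y K : ℕ) : ℝ) = y := by rw [max_eq_left hy]
        have e2 : ((max Z K : ℕ) : ℝ) = Z := by rw [max_eq_left (by omega)]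
        rw [e1, e2]
        have hZ' : 2 * (y : ℝ) ≤ Z := by exact_mod_cast hZ
        have : 2 / (Z : ℝ) ≤ 1 / y := by
          rw [div_le_div_iff₀ (by linarith) hy0]
          linarith
        calc 2 / (Z : ℝ) + 1 / y ≤ 1 / y + 1 / y := by linarith
          _ = 2 / y := by ring
    · simp only [if_neg hy] at hv
      rw [scale, if_neg hy]
      have : ξ' = ξ := funext hv
      rw [this]
      exact ⟨hlt, hdef⟩

open Classical in
theorem diCutUpdate_logStar_add (inp : LocalInput (ℝ × ℝ)) (j x : ℕ) (vals : List ℕ) :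
    diCutUpdate Q K p f inp (logStar inp.n + j) x vals
      = if x = j ∧ x < Q then (if GreedyChoice Q inp x vals then Q + 1 else Q) else x := by
  simp [diCutUpdate]

/-- The set is read off from the run: `v` is in if its number is `Q + 1` right after its own
colour's round. Colours are below `Q`, so decided values are unambiguous and never change again. -/
theorem publicValue_decision (hcol : ∀ v,
      publicValue (𝒩) (diCutUpdate Q K p f) (logStar (Fintype.card V)) v < Q) :
    ∃ X : V → Bool,
      (∀ j v, publicValue (𝒩) (diCutUpdate Q K p f) (logStar (Fintype.card V) + j) v
        = if publicValue (𝒩) (diCutUpdate Q K p f) (logStar (Fintype.card V)) v < j then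
            (if X v then Q + 1 else Q)
          else publicValue (𝒩) (diCutUpdate Q K p f) (logStar (Fintype.card V)) v) ∧
      ∀ o : V → ℝ, (∀ u, 0 ≤ o u) → (∀ u, o u ≤ 1) →
        cutForm (fun u v =>
            if publicValue (𝒩) (diCutUpdate Q K p f) (logStar (Fintype.card V)) u
              = publicValue (𝒩) (diCutUpdate Q K p f) (logStar (Fintype.card V)) v then 0
            else G.arcWeight u v) o
          ≤ 3 * cutForm (fun u v =>
            if publicValue (𝒩) (diCutUpdate Q K p f) (logStar (Fintype.card V)) u
              = publicValue (𝒩) (diCutUpdate Q K p f) (logStar (Fintype.card V)) v then 0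
            else G.arcWeight u v) (fun u => if X u then 1 else 0) := by
  classical
  have hstep : ∀ j v, publicValue (𝒩) (diCutUpdate Q K p f) (logStar (Fintype.card V) + (j + 1)) v
      = if publicValue (𝒩) (diCutUpdate Q K p f) (logStar (Fintype.card V) + j) v = j ∧
          publicValue (𝒩) (diCutUpdate Q K p f) (logStar (Fintype.card V) + j) v < Q then
          (if GreedyChoice Q ((𝒩).localInput v)
            (publicValue (𝒩) (diCutUpdate Q K p f) (logStar (Fintype.card V) + j) v)
            (List.ofFn fun i : Fin ((𝒩).deg v) =>
              publicValue (𝒩) (diCutUpdate Q K p f) (logStar (Fintype.card V) + j)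
                ((𝒩).port v i).1) then Q + 1 else Q)
        else publicValue (𝒩) (diCutUpdate Q K p f) (logStar (Fintype.card V) + j) v := by
    intro j v
    exact diCutUpdate_logStar_add ((𝒩).localInput v) j _ _
  generalize hη : (fun j => publicValue (𝒩) (diCutUpdate Q K p f)
    (logStar (Fintype.card V) + j)) = η
  have hη0 : publicValue (𝒩) (diCutUpdate Q K p f) (logStar (Fintype.card V)) = η 0 := by
    rw [← hη]
    rfl
  have hηj : ∀ j, publicValue (𝒩) (diCutUpdate Q K p f) (logStar (Fintype.card V) + j) = η j :=
    fun j => by rw [← hη]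
  simp only [hηj, hη0] at hstep hcol ⊢
  generalize hc : η 0 = col at *
  have hval : ∀ j v, η j v = if col v < j then
      (if decide (η (col v + 1) v = Q + 1) then Q + 1 else Q) else col v := by
    intro j v
    induction j with
    | zero => simp [hc]
    | succ j ih =>
      rcases lt_trichotomy (col v) j with h | h | h
      · rw [if_pos h] at ih
        have hge : ¬ η j v < Q := by
          rw [ih]
          split_ifs <;> omega
        rw [hstep, if_neg (fun h' => hge h'.2), ih, if_pos (show col v < j + 1 by omega)]
      · subst h
        rw [if_neg (lt_irrefl _)] at ih
        rw [if_pos (by omega), hstep, ih, if_pos ⟨rfl, hcol v⟩]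
        split_ifs <;> simp_all
      · rw [if_neg h.not_gt] at ih
        rw [hstep, ih, if_neg (by omega), if_neg (by omega)]
  refine ⟨fun v => decide (η (col v + 1) v = Q + 1), hval, ?_⟩
  generalize hX : (fun v => decide (η (col v + 1) v = Q + 1)) = X
  have hXv : ∀ v, decide (η (col v + 1) v = Q + 1) = X v := fun v => by rw [← hX]
  simp only [hXv] at hval
  intro o ho0 ho1
  refine cutForm_le_three_mul_of_doubleGreedy (col := col) ?_ ?_ ?_ ho0 ho1
  · intro u v
    split_ifs
    · exact le_rfl
    · exact G.arcWeight_nonneg u v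
  · intro u v h
    simp [h]
  · intro v
    have h1 : X v = true ↔ GreedyChoice Q ((𝒩).localInput v) (col v)
        (List.ofFn fun i : Fin ((𝒩).deg v) => η (col v) ((𝒩).port v i).1) := by
      have hcv : η (col v) v = col v := by rw [hval, if_neg (lt_irrefl _)]
      rw [← hXv, decide_eq_true_iff, hstep, hcv, if_pos ⟨rfl, hcol v⟩]
      split_ifs with h <;> simp [h]
    rw [h1, GreedyChoice, linkSum_network _ _ _ _ _ _ _ _ (by simp),
      linkSum_network _ _ _ _ _ _ _ _ (by simp)]
    refine iff_of_eq (congrArg₂ (fun x y : ℝ => -x ≤ y) ?_ ?_)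
    -- Smaller colours have decided and show `Q` or `Q + 1`; equal colours are ignored; larger ones
    -- still show a colour, counted as 1 on the left and 0 on the right.
    all_goals
      refine sum_congr rfl fun u _ => ?_
      have hcu := hcol u
      have hcv := hcol v
      rw [hval, hybrid]
      rcases lt_trichotomy (col u) (col v) with h | h | h
      · by_cases hx : X u = true
        · simp [h, h.ne, h.ne', hx, show Q + 1 ≠ col v by omega]
        · simp [h, h.ne, h.ne', hx, show Q ≠ col v by omega]
      · simp [h]
      · simp [h.not_gt, h.ne, h.ne', show col u ≠ Q by omega, show col u ≠ Q + 1 by omega]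

end WeightedDigraph

/-! ### Choice of constants and conclusion -/

theorem mainTheorem2 (ε : ℝ) (hε : 0 < ε) (c : ℕ) :
    ∃ (A : Congest.Algorithm (ℝ × ℝ) Bool) (B C : ℕ),
      ∀ (V : Type*) [Fintype V] (G : WeightedDigraph V)
        (ident : V → ℕ) (ident_injective : Function.Injective ident)
        (_ : ∀ v, ident v ≤ Fintype.card V ^ c)
        (deg : V → ℕ)
        (port : (v : V) → Fin (deg v) ≃ {u : V // (SimpleGraph.fromRel G.Adj).Adj v u}),
        A.MessagesAtMost (G.network ident ident_injective deg port)
            (B * Nat.log 2 (Fintype.card V)) ∧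
          ∃ X : V → Bool,
            A.HaltsWithin (G.network ident ident_injective deg port)
              (C * logStar (Fintype.card V)) X ∧
            G.IsDiCutApprox (1 / 3 - ε) X := by
  -- Exceeding `c` puts identifiers strictly below `n ^ D`; `mul_self_le_pow` needs `5 ≤ D`.
  set D := c + 5 with hD
  obtain ⟨m, hm⟩ := exists_nat_ge (6 / ε)
  -- The first summand serves `mul_self_le_pow`; `m` forces the final defect below `ε / 3`.
  set K := 16 * D ^ 2 + m with hK
  have hK4 : 4 ≤ K := by nlinarith
  set Q := 2 ^ (K * D) with hQ
  choose p f hpf using exists_code_family D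
  refine ⟨Congest.broadcast (fun n => (Q + 2) * logStar n)
    (WeightedDigraph.diCutUpdate Q K p f) (fun x => decide (x = Q + 1)),
    2 * (K * D + 1), Q + 2, ?_⟩
  intro V _ G ident ident_injective hident deg port
  rcases le_or_gt (Fintype.card V) 1 with hn | hn
  · have h0 : logStar (Fintype.card V) = 0 := logStar_eq_zero hn
    refine ⟨Congest.messagesAtMost_broadcast _ _ _ _ fun t ht => ?_, _,
      Congest.haltsWithin_broadcast _ _ _ _, fun Y => ?_⟩
    · simp [h0] at ht
    · have := Fintype.card_le_one_iff_subsingleton.1 hn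
      simp only [G.diCut_of_subsingleton, mul_zero, le_refl]
  · have hs := one_le_logStar hn
    have hident' : ∀ v, ident v < Fintype.card V ^ D := by
      intro v
      refine (hident v).trans_lt (Nat.pow_lt_pow_right hn (by omega))
    have hinv := fun t (ht : t ≤ logStar (Fintype.card V)) =>
      G.publicValue_reduction_invariant (Q := Q) ident ident_injective deg port
        (show 5 ≤ D by omega) (show 16 * D ^ 2 ≤ K by omega)
        (fun y hy => hpf y (by omega) hy) hident' ht
    have hlog := log_iterate_scale_logStar_lt K (Fintype.card V) (by omega)
    obtain ⟨hcol, hdef⟩ := hinv _ le_rfl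
    have hcolQ : ∀ v, Congest.publicValue (G.network ident ident_injective deg port)
        (WeightedDigraph.diCutUpdate Q K p f) (logStar (Fintype.card V)) v < Q := by
      intro v
      refine (hcol v).trans_le ?_
      rw [hQ, pow_mul]
      exact Nat.pow_le_pow_left ((Nat.lt_pow_succ_log_self (by norm_num) _).le.trans
        (Nat.pow_le_pow_right (by norm_num) hlog)) D
    obtain ⟨X, hX, hgreedy⟩ := G.publicValue_decision ident ident_injective deg port hcolQ
    refine ⟨Congest.messagesAtMost_broadcast _ _ _ _ fun t ht v => ?_, X, ?_, fun Y => ?_⟩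
    · apply size_le_of_lt_pow hn
      rcases le_or_gt t (logStar (Fintype.card V)) with h | h
      · refine ((hinv t h).1 v).trans_le ((Nat.pow_le_pow_left (iterate_scale_le _ _ _) D).trans
          (Nat.pow_le_pow_right (by omega) (by nlinarith)))
      · obtain ⟨j, rfl⟩ := Nat.exists_eq_add_of_le h.le
        have hle : 2 ^ (K * D + 1) ≤ Fintype.card V ^ (K * D + 1) := Nat.pow_le_pow_left hn _
        have hQ2 : 2 ≤ Q := by
          rw [hQ]
          exact Nat.le_self_pow (by positivity) 2
        have hcv := hcolQ v
        refine lt_of_lt_of_le ?_ hle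
        rw [pow_succ, ← hQ, hX j v]
        split_ifs <;> omega
    · have hh := Congest.haltsWithin_broadcast (G.network ident ident_injective deg port)
        (fun n => (Q + 2) * logStar n) (WeightedDigraph.diCutUpdate Q K p f) (fun x => decide (x = Q + 1))
      convert hh using 2 with v
      -- All colours have decided after `logStar n + Q` rounds; `1 ≤ logStar n` fits this sum under
      -- the product.
      obtain ⟨j, hj⟩ := Nat.exists_eq_add_of_le
        (show logStar (Fintype.card V) + Q ≤ (Q + 2) * logStar (Fintype.card V) by nlinarith)
      simp only [hj, add_assoc]
      rw [hX, if_pos (by have := hcolQ v; omega)]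
      cases X v <;> simp
    · have hKε : 6 / ε ≤ K := hm.trans (by rw [hK]; push_cast; nlinarith [sq_nonneg (D : ℝ)])
      set E : ℝ := 2 / (max ((scale K)^[logStar (Fintype.card V)] (Fintype.card V)) K : ℕ)
      have hK4' : (4 : ℝ) ≤ K := by exact_mod_cast hK4
      have hE0 : 0 ≤ E := by positivity
      have hEK : E ≤ 2 / K := div_le_div_of_nonneg_left (by norm_num) (by linarith)
        (Nat.cast_le.2 (le_max_right _ _))
      have hE2 : E ≤ 1 / 2 := hEK.trans (by rw [div_le_div_iff₀] <;> linarith)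
      have hEε : E ≤ ε / 3 := by
        refine hEK.trans ?_
        rw [div_le_iff₀ hε] at hKε
        rw [div_le_div_iff₀] <;> linarith
      have hbound := cutForm_le_of_hasDefect G.arcWeight_nonneg hE0 hE2 hdef
        (x := fun u => if X u then 1 else 0) (o := fun u => if Y u then 1 else 0)
        (fun u => by positivity) (fun u => by split_ifs <;> norm_num) hgreedy
        (fun u => by positivity) (fun u => by split_ifs <;> norm_num)
      rw [← G.diCut_eq_cutForm, ← G.diCut_eq_cutForm] at hbound
      have hnonneg : ∀ Z, 0 ≤ G.diCut Z := fun Z => Finset.sum_nonneg fun u _ =>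
        Finset.sum_nonneg fun v _ => by
          split_ifs
          · exact G.arcWeight_nonneg u v
          · exact le_rfl
      rcases le_or_gt (1 / 3 - ε) 0 with h | h
      · exact (mul_nonpos_of_nonpos_of_nonneg h (hnonneg Y)).trans (hnonneg X)
      · refine (mul_le_mul_of_nonneg_left hbound h.le).trans ?_
        rw [← mul_assoc]
        refine mul_le_of_le_one_left (hnonneg X) ?_
        -- With `E ≤ ε / 3`: `(1/3 - ε) * (3 + 8 * ε) = 1 - ε/3 - 8 * ε ^ 2`.
        nlinarith
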